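/- Let $\mathbf{Comp}$ be the class of compact Hausdorff spaces. A cover of $X\in\mathbf{Comp}$ is a pair $(Y,f)$ with $f\colon Y\to X$ a perfect irreducible continuous surjection (irreducible: $f(F)\ne X$ for every proper closed $F\subset Y$). For covers of $X$, $(X_1,f_1)\le(X_2,f_2)$ means $f_2=f_1\circ f$ for some continuous $f\colon X_2\to X_1$. A covering operator $c$ assigns to each $X\in\mathbf{Comp}$ a cover $(cX,c_X)$ which is the minimum among the covers $(Y,f)$ of $X$ with $Y\in\mathrm{fix}(c)=\{Z: c_Z\text{ is a homeomorphism}\}$ (in particular $cX\in\mathrm{fix}(c)$). Let $\mathbf{W}^*$ be the category of Archimedean (real) vector lattices with distinguished strong unit and unit-preserving vector lattice homomorphisms. An essential extension of $A\in\mathbf{W}^*$ is a pair $(B,f)$ with $f\colon A\to B$ an injective $\mathbf{W}^*$-morphism such that every $\mathbf{W}^*$-morphism $k\colon B\to C$ with $k\circ f$ injective is injective. For essential extensions of $A$, $(B_1,f_1)\le(B_2,f_2)$ means $f_2=f\circ f_1$ for some $\mathbf{W}^*$-morphism $f\colon B_1\to B_2$; extensions that are $\le$ each other are identified. A hull operator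 $h$ assigns to each $A\in\mathbf{W}^*$ an essential extension $(hA,h_A)$ which is the minimum among the essential extensions $(B,f)$ of $A$ with $B\in\mathrm{fix}(h)=\{D: h_D\text{ is an isomorphism}\}$ (in particular $hA\in\mathrm{fix}(h)$). For $A\in\mathbf{W}^*$ with unit $\mathbf{1}_A$, let $YA$ be the Yosida space: the set of ideals $M$ of $A$ maximal with respect to not containing $\mathbf{1}_A$, with the hull-kernel topology; it is compact Hausdorff. Let $\nu_A\colon A\to C(YA)$ be the Yosida embedding, where $\nu_A(a)(M)$ is the real number $r$ with $a-r\mathbf{1}_A\in M$. Here the unit of $C(X)$ is the constant function $1$. For a covering operator $c$ put $\mu(c)A=C(cYA)$ and $\mu(c)_A(a)=\nu_A(a)\circ c_{YA}$. Theorem. (1) If $c$ is a covering operator, then $\mu(c)$ is a hull operator on $\mathbf{W}^*$. (2) Every $X\in\mathbf{Comp}$ has a maximum cover $(gX,g_X)$ and every $A\in\mathbf{W}^*$ has a maximum essential extension $(eA,e_A)$. The resulting $g$ (the Gleason operator) is a covering operator, $e$ (the essential completion) is a hull operator, and $\mu(g)=e$; that is, $(\mu(g)A,\mu(g)_A)$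 and $(eA,e_A)$ are the same essential extension of $A$, for every $A$. (3) The identity $\mathrm{id}$ (with $\mathrm{id}\,X=X$) is a covering operator, the uniform completion $u$, with $uA=C(YA)$ and $u_A=\nu_A$, is a hull operator, $\nu_A(A)$ is uniformly dense in $C(YA)$ for every $A$, and $\mu(\mathrm{id})=u$. -/

import Mathlib

universe u

/-! ## Compact Hausdorff spaces, covers, covering operators -/

/-- `f : Y → X` is a covering map: a perfect irreducible continuous surjection. -/
structure IsPerfectIrreducible {Y X : Type*} [TopologicalSpace Y] [TopologicalSpace X] (f : Y → X) :
    Prop where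
  continuous : Continuous f
  isClosedMap : IsClosedMap f
  isCompact_fiber : ∀ x, IsCompact (f ⁻¹' {x})
  surjective : Function.Surjective f
  irreducible : ∀ F : Set Y, IsClosed F → F ≠ Set.univ → f '' F ≠ Set.univ

/-- A cover of the compact Hausdorff space `X`. -/
structure CompCover (X : CompHaus.{u}) where
  space : CompHaus.{u}
  map : C(space, X)
  isCover : IsPerfectIrreducible map

/-- The order on covers of `X`: `(X₁, f₁) ≤ (X₂, f₂)` iff `f₂ = f₁ ∘ f` for some continuous
`f : X₂ → X₁`. -/
def CompCover.le {X : CompHaus.{u}} (P Q : CompCover X) : Prop :=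
  ∃ f : C(Q.space, P.space), Q.map = P.map.comp f

/-- A choice of a cover `(cX, c_X)` for every compact Hausdorff space `X`. -/
abbrev CoverAssignment : Type (u + 1) := ∀ X : CompHaus.{u}, CompCover X

/-- `fix(c)`: the spaces `X` for which `c_X` is a homeomorphism. -/
def CoverAssignment.fix (c : CoverAssignment.{u}) : Set CompHaus.{u} :=
  {X | IsHomeomorph (c X).map}

/-- `c ∈ coComp`: for every `X`, the cover `(cX, c_X)` is the minimum among the covers `(Y, f)` of
`X` with `Y ∈ fix(c)`. -/
def IsCoveringOperator (c : CoverAssignment.{u}) : Prop :=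
  ∀ X : CompHaus.{u}, (c X).space ∈ c.fix ∧
    ∀ P : CompCover X, P.space ∈ c.fix → (c X).le P

/-- `g` is the Gleason operator: it assigns to every `X` the maximum cover of `X`. -/
def IsGleasonOperator (g : CoverAssignment.{u}) : Prop :=
  ∀ (X : CompHaus.{u}) (P : CompCover X), P.le (g X)

/-- The identity covering operator. -/
def idCover : CoverAssignment.{u} := fun X =>
  { space := X
    map := ContinuousMap.id X
    isCover :=
      { continuous := continuous_id
        isClosedMap := IsClosedMap.id
        isCompact_fiber := fun x => by simp
        surjective := Function.surjective_id
        irreducible := fun F _ h => by simpa using h } }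

/-! ## The category `W*` -/

/-- An Archimedean real vector lattice with a distinguished strong unit. -/
structure WStar : Type (u + 1) where
  carrier : Type u
  [addCommGroup : AddCommGroup carrier]
  [lattice : Lattice carrier]
  [isOrderedAddMonoid : IsOrderedAddMonoid carrier]
  [module : Module ℝ carrier]
  [posSMulMono : PosSMulMono ℝ carrier]
  archimedean : ∀ a b : carrier, 0 ≤ a → (∀ n : ℕ, n • a ≤ b) → a = 0
  unit : carrier
  unit_nonneg : 0 ≤ unit
  strong_unit : ∀ a : carrier, ∃ n : ℕ, |a| ≤ n • unit

namespace WStar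

instance : CoeSort WStar.{u} (Type u) := ⟨WStar.carrier⟩

attribute [instance] addCommGroup lattice isOrderedAddMonoid module posSMulMono

/-- `W*`-morphisms: unit-preserving vector lattice homomorphisms. -/
structure Hom (A B : WStar.{u}) extends A →ₗ[ℝ] B where
  map_sup' : ∀ a b : A, toFun (a ⊔ b) = toFun a ⊔ toFun b
  map_inf' : ∀ a b : A, toFun (a ⊓ b) = toFun a ⊓ toFun b
  map_unit' : toFun A.unit = B.unit

instance (A B : WStar.{u}) : CoeFun (Hom A B) (fun _ => A → B) := ⟨fun f => f.toFun⟩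

/-- The identity morphism. -/
def Hom.id (A : WStar.{u}) : Hom A A where
  toLinearMap := LinearMap.id
  map_sup' _ _ := rfl
  map_inf' _ _ := rfl
  map_unit' := rfl

/-- Composition of morphisms: `g.comp f = g ∘ f`. -/
def Hom.comp {A B C : WStar.{u}} (g : Hom B C) (f : Hom A B) : Hom A C where
  toLinearMap := g.toLinearMap.comp f.toLinearMap
  map_sup' a b := by
    change g (f (a ⊔ b)) = g (f a) ⊔ g (f b)
    rw [f.map_sup', g.map_sup']
  map_inf' a b := by
    change g (f (a ⊓ b)) = g (f a) ⊓ g (f b)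
    rw [f.map_inf', g.map_inf']
  map_unit' := by
    change g (f A.unit) = C.unit
    rw [f.map_unit', g.map_unit']

/-- `f` is a `W*`-isomorphism. -/
def Hom.IsIso {A B : WStar.{u}} (f : Hom A B) : Prop :=
  ∃ g : Hom B A, g.comp f = Hom.id A ∧ f.comp g = Hom.id B

/-- `f` is an essential embedding: `f` is an embedding, and every morphism `k` with `k ∘ f` monic is
monic (monic means injective). -/
def Hom.IsEssential {A B : WStar.{u}} (f : Hom A B) : Prop :=
  Function.Injective f ∧
    ∀ (C : WStar.{u}) (k : Hom B C), Function.Injective (k.comp f) → Function.Injective k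

/-- A `W*`-object `B` together with a morphism `A → B`. -/
structure Extension (A : WStar.{u}) where
  obj : WStar.{u}
  hom : Hom A obj

/-- `(B, f) ∈ ext A`: `(B, f)` is an essential extension of `A`. -/
def Extension.IsEssential {A : WStar.{u}} (P : Extension A) : Prop := P.hom.IsEssential

/-- The order on extensions of `A`: `(B₁, f₁) ≤ (B₂, f₂)` iff `f₂ = f ∘ f₁` for some morphism
`f : B₁ → B₂`. -/
def Extension.le {A : WStar.{u}} (P Q : Extension A) : Prop :=
  ∃ f : Hom P.obj Q.obj, Q.hom = f.comp P.hom

/-- A choice of an object `hA` and a morphism `h_A : A → hA` for every `A ∈ W*`. -/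
abbrev ExtensionAssignment : Type (u + 1) := ∀ A : WStar.{u}, Extension A

/-- `fix(h)`: the objects `A` for which `h_A` is an isomorphism. -/
def ExtensionAssignment.fix (h : ExtensionAssignment.{u}) : Set WStar.{u} :=
  {A | (h A).hom.IsIso}

/-- `h ∈ hoW*`: every `(hA, h_A)` is an essential extension of `A`, and it is the minimum among the
essential extensions `(B, f)` of `A` with `B ∈ fix(h)`. -/
def IsHullOperator (h : ExtensionAssignment.{u}) : Prop :=
  ∀ A : WStar.{u}, (h A).IsEssential ∧ (h A).obj ∈ h.fix ∧
    ∀ P : Extension A, P.IsEssential → P.obj ∈ h.fix → (h A).le P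

/-- `e` is the essential completion operator: it assigns to every `A` the maximum essential
extension of `A`. -/
def IsEssentialCompletionOperator (e : ExtensionAssignment.{u}) : Prop :=
  ∀ A : WStar.{u}, (e A).IsEssential ∧ ∀ P : Extension A, P.IsEssential → P.le (e A)

/-- `h` and `k` are the same operator: for every `A`, the pairs `(hA, h_A)` and `(kA, k_A)`
represent the same element of `ext A`, the preordered collection of essential extensions of `A`
modulo `(B₁, f₁) ≤ (B₂, f₂) ≤ (B₁, f₁)`. -/
def SameOperator (h k : ExtensionAssignment.{u}) : Prop :=
  ∀ A : WStar.{u}, (h A).IsEssential ∧ (k A).IsEssential ∧ (h A).le (k A) ∧ (k A).le (h A)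

/-- `C(X)` as a `W*`-object; the strong unit is the constant function `1`. -/
def ofCont (X : CompHaus.{u}) : WStar.{u} where
  carrier := C(X, ℝ)
  posSMulMono := ⟨fun r hr f g hfg => by
    intro x
    have h : f x ≤ g x := ContinuousMap.le_def.1 hfg x
    exact mul_le_mul_of_nonneg_left h hr⟩
  archimedean a b ha h := by
    ext x
    by_contra hx
    have h0 : 0 < a x := lt_of_le_of_ne (ha x) (Ne.symm hx)
    obtain ⟨n, hn⟩ := Archimedean.arch (b x + 1) h0
    have h1 : (n • a) x ≤ b x := h n x
    rw [ContinuousMap.smul_apply] at h1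
    linarith
  unit := 1
  unit_nonneg := fun x => zero_le_one
  strong_unit a := by
    obtain ⟨n, hn⟩ := exists_nat_ge ‖a‖
    refine ⟨n, fun x => ?_⟩
    have h1 : |a x| ≤ ‖a‖ := a.norm_coe_le_norm x
    simpa using h1.trans hn

/-- The morphism `C(X) → C(Y)`, `k ↦ k ∘ p`, induced by a continuous map `p : Y → X`. -/
def ofContMap {X Y : CompHaus.{u}} (p : C(Y, X)) : Hom (ofCont X) (ofCont Y) where
  toFun k := ContinuousMap.comp (k : C(X, ℝ)) p
  map_add' _ _ := rfl
  map_smul' _ _ := rfl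
  map_sup' _ _ := rfl
  map_inf' _ _ := rfl
  map_unit' := rfl

/-! ## The Yosida representation -/

/-- Ideals (solid linear subspaces) of `A` that do not contain the unit. -/
def IsUnitFreeIdeal (A : WStar.{u}) (I : Submodule ℝ A) : Prop :=
  LatticeOrderedAddCommGroup.IsSolid (I : Set A) ∧ A.unit ∉ I

/-- The points of the Yosida space: the ideals of `A` maximal with respect to not containing the
unit. -/
def YosidaSpace (A : WStar.{u}) : Type u :=
  {M : Submodule ℝ A // Maximal (IsUnitFreeIdeal A) M}

/-- The hull-kernel topology: the sets `{M | a ∈ M}` form a subbase (in fact, a base) for the closed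
sets. -/
instance (A : WStar.{u}) : TopologicalSpace (YosidaSpace A) :=
  TopologicalSpace.generateFrom (Set.range fun a : A => {M : YosidaSpace A | a ∉ M.1})

section Yosida

variable {A : WStar.{u}}

theorem YosidaSpace.solid (M : YosidaSpace A) {a b : A} (hb : b ∈ M.1) (h : |a| ≤ |b|) :
    a ∈ M.1 := M.2.1.1 hb h

theorem YosidaSpace.abs_mem (M : YosidaSpace A) {a : A} (ha : a ∈ M.1) : |a| ∈ M.1 :=
  M.solid ha (by rw [abs_abs])

theorem YosidaSpace.mem_of_le (M : YosidaSpace A) {a b : A} (hb : b ∈ M.1) (h : |a| ≤ b) :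
    a ∈ M.1 := M.solid hb (h.trans (le_abs_self b))

theorem YosidaSpace.unit_smul (M : YosidaSpace A) {r : ℝ} (h : r • A.unit ∈ M.1) : r = 0 := by
  by_contra hr
  refine M.2.1.2 ?_
  have := M.1.smul_mem r⁻¹ h
  rwa [smul_smul, inv_mul_cancel₀ hr, one_smul] at this

/-- Maximality: if `0 ≤ b ∉ M` then `u ≤ m + k b` for some `m ∈ M` and `k ≥ 0`. -/
theorem YosidaSpace.exists_le (M : YosidaSpace A) {b : A} (hb0 : 0 ≤ b) (hb : b ∉ M.1) :
    ∃ m ∈ M.1, 0 ≤ m ∧ ∃ k : ℝ, 0 < k ∧ A.unit ≤ m + k • b := by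
  let J : Submodule ℝ A :=
    { carrier := {x | ∃ m ∈ M.1, 0 ≤ m ∧ ∃ k : ℝ, 0 < k ∧ |x| ≤ m + k • b}
      zero_mem' := ⟨0, M.1.zero_mem, le_rfl, 1, one_pos, by simpa using hb0⟩
      add_mem' := by
        rintro x y ⟨m, hm, hm0, k, hk, h⟩ ⟨m', hm', hm0', k', hk', h'⟩
        refine ⟨m + m', M.1.add_mem hm hm', add_nonneg hm0 hm0', k + k', add_pos hk hk', ?_⟩
        calc |x + y| ≤ |x| + |y| := abs_add_le x y
          _ ≤ (m + k • b) + (m' + k' • b) := add_le_add h h'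
          _ = _ := by module
      smul_mem' := by
        rintro r x ⟨m, hm, hm0, k, hk, h⟩
        have hr : 0 ≤ |r| + 1 := by positivity
        refine ⟨(|r| + 1) • m, M.1.smul_mem _ hm, smul_nonneg hr hm0, (|r| + 1) * k,
          by positivity, ?_⟩
        have h1 : |r • x| ≤ (|r| + 1) • |x| := by
          have hx : 0 ≤ |x| := abs_nonneg x
          have key : ∀ s : ℝ, s ≤ |r| + 1 → s • |x| ≤ (|r| + 1) • |x| := by
            intro s hs
            have := smul_nonneg (sub_nonneg.2 hs) hx
            rwa [sub_smul, sub_nonneg] at this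
          have key2 : ∀ s : ℝ, |s| ≤ |r| + 1 → s • x ≤ (|r| + 1) • |x| := by
            intro s hs
            rcases le_total 0 s with h0 | h0
            · exact (smul_le_smul_of_nonneg_left (le_abs_self x) h0).trans
                (key s ((le_abs_self s).trans hs))
            · have h2 : s • x = (-s) • (-x) := by module
              rw [h2]
              exact (smul_le_smul_of_nonneg_left (neg_le_abs x) (neg_nonneg.2 h0)).trans
                (key (-s) ((neg_le_abs s).trans hs))
          refine abs_le'.2 ⟨key2 r (by linarith), ?_⟩
          rw [← neg_smul]
          exact key2 (-r) (by rw [abs_neg]; linarith)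
        calc |r • x| ≤ (|r| + 1) • |x| := h1
          _ ≤ (|r| + 1) • (m + k • b) := smul_le_smul_of_nonneg_left h hr
          _ = _ := by module }
  by_contra hcon
  have hJ : IsUnitFreeIdeal A J := by
    refine ⟨?_, ?_⟩
    · rintro x ⟨m, hm, hm0, k, hk, h⟩ y hy
      exact ⟨m, hm, hm0, k, hk, le_trans hy h⟩
    · rintro ⟨m, hm, hm0, k, hk, h⟩
      exact hcon ⟨m, hm, hm0, k, hk, (le_abs_self _).trans h⟩
  have hMJ : M.1 ≤ J := fun x hx => ⟨|x|, M.abs_mem hx, abs_nonneg x, 1, one_pos, by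
    simpa using hb0⟩
  have hbJ : b ∈ J := ⟨0, M.1.zero_mem, le_rfl, 1, one_pos, by simp [abs_of_nonneg hb0]⟩
  exact hb (M.2.2 hJ hMJ hbJ)

theorem YosidaSpace.posPart_or (M : YosidaSpace A) (a : A) : a⁺ ∈ M.1 ∨ a⁻ ∈ M.1 := by
  by_contra! hcon
  obtain ⟨m, hm, hm0, k, hk, h⟩ := M.exists_le (posPart_nonneg a) hcon.1
  obtain ⟨m', hm', hm0', k', hk', h'⟩ := M.exists_le (negPart_nonneg a) hcon.2
  have hinf : a⁺ ⊓ a⁻ = 0 := posPart_inf_negPart_eq_zero a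
  set K := k + k' with hK
  have hKpos : 0 < K := add_pos hk hk'
  have e1 : A.unit ≤ (m + m') + K • a⁺ := by
    refine h.trans ?_
    have : 0 ≤ m' + k' • a⁺ := add_nonneg hm0' (smul_nonneg hk'.le (posPart_nonneg a))
    calc m + k • a⁺ ≤ (m + k • a⁺) + (m' + k' • a⁺) := le_add_of_nonneg_right this
      _ = _ := by rw [hK]; module
  have e2 : A.unit ≤ (m + m') + K • a⁻ := by
    refine h'.trans ?_
    have : 0 ≤ m + k • a⁻ := add_nonneg hm0 (smul_nonneg hk.le (negPart_nonneg a))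
    calc m' + k' • a⁻ ≤ (m' + k' • a⁻) + (m + k • a⁻) := le_add_of_nonneg_right this
      _ = _ := by rw [hK]; module
  have e3 : A.unit - (m + m') ≤ 0 := by
    have s1 : K⁻¹ • (A.unit - (m + m')) ≤ a⁺ := by
      have := smul_le_smul_of_nonneg_left (sub_le_iff_le_add'.2 e1) (inv_nonneg.2 hKpos.le)
      rwa [smul_smul, inv_mul_cancel₀ hKpos.ne', one_smul] at this
    have s2 : K⁻¹ • (A.unit - (m + m')) ≤ a⁻ := by
      have := smul_le_smul_of_nonneg_left (sub_le_iff_le_add'.2 e2) (inv_nonneg.2 hKpos.le)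
      rwa [smul_smul, inv_mul_cancel₀ hKpos.ne', one_smul] at this
    have s3 := le_inf s1 s2
    rw [hinf] at s3
    have := smul_le_smul_of_nonneg_left s3 hKpos.le
    rwa [smul_smul, mul_inv_cancel₀ hKpos.ne', one_smul, smul_zero] at this
  refine M.2.1.2 (M.mem_of_le (M.1.add_mem hm hm') ?_)
  rw [abs_of_nonneg A.unit_nonneg]
  exact sub_nonpos.1 e3

/-- `A / M ≅ ℝ`, with the unit corresponding to `1`. -/
theorem YosidaSpace.exists_value (M : YosidaSpace A) (a : A) :
    ∃ r : ℝ, a - r • A.unit ∈ M.1 := by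
  let S : Set ℝ := {r | (a - r • A.unit)⁺ ∈ M.1}
  obtain ⟨n, hn⟩ := A.strong_unit a
  have hn' : n • A.unit = (n : ℝ) • A.unit := (Nat.cast_smul_eq_nsmul ℝ n A.unit).symm
  rw [hn'] at hn
  have hne : S.Nonempty := by
    refine ⟨n, ?_⟩
    have : a - (n : ℝ) • A.unit ≤ 0 := sub_nonpos.2 ((le_abs_self a).trans hn)
    change (a - (n : ℝ) • A.unit)⁺ ∈ M.1
    rw [posPart_eq_zero.2 this]
    exact M.1.zero_mem
  have hbdd : BddBelow S := by
    refine ⟨-(n : ℝ), fun r hr => ?_⟩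
    by_contra! hlt
    have hpos : 0 < -(n : ℝ) - r := by linarith
    have h1 : (-(n : ℝ) - r) • A.unit ≤ (a - r • A.unit)⁺ := by
      refine le_trans ?_ (le_posPart _)
      have : -a ≤ (n : ℝ) • A.unit := (neg_le_abs a).trans hn
      have h2 : -((n : ℝ) • A.unit) ≤ a := neg_le.1 this
      calc (-(n : ℝ) - r) • A.unit = -((n : ℝ) • A.unit) - r • A.unit := by module
        _ ≤ _ := sub_le_sub_right h2 _
    have h3 : (-(n : ℝ) - r) • A.unit ∈ M.1 := by
      refine M.mem_of_le hr ?_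
      rwa [abs_of_nonneg (smul_nonneg hpos.le A.unit_nonneg)]
    exact hpos.ne' (M.unit_smul h3)
  refine ⟨sInf S, ?_⟩
  set r := sInf S with hr
  by_contra hb
  have hb' : |a - r • A.unit| ∉ M.1 := fun h => hb (M.mem_of_le h le_rfl)
  obtain ⟨m, hm, -, k, hk, h⟩ := M.exists_le (abs_nonneg _) hb'
  set ε : ℝ := (2 * k)⁻¹ with hε
  have hεpos : 0 < ε := by positivity
  -- upper estimate
  obtain ⟨s, hs, hsr⟩ := exists_lt_of_csInf_lt hne (show sInf S < r + ε by linarith)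
  have hup : a - r • A.unit ≤ (a - s • A.unit)⁺ + ε • A.unit := by
    have h1 : (s - r) • A.unit ≤ ε • A.unit := by
      have := smul_nonneg (show 0 ≤ ε - (s - r) by linarith) A.unit_nonneg
      rwa [sub_smul, sub_nonneg] at this
    calc a - r • A.unit = (a - s • A.unit) + (s - r) • A.unit := by module
      _ ≤ _ := add_le_add (le_posPart _) h1
  -- lower estimate
  have hlo_mem : (a - (r - ε) • A.unit)⁻ ∈ M.1 := by
    rcases M.posPart_or (a - (r - ε) • A.unit) with h1 | h1
    · have : r ≤ r - ε := csInf_le hbdd h1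
      linarith
    · exact h1
  have hlo : -(a - r • A.unit) ≤ (a - (r - ε) • A.unit)⁻ + ε • A.unit := by
    calc -(a - r • A.unit) = -(a - (r - ε) • A.unit) + ε • A.unit := by module
      _ ≤ _ := add_le_add_left (neg_le_negPart _) _
  have habs : |a - r • A.unit| ≤
      ((a - s • A.unit)⁺ + (a - (r - ε) • A.unit)⁻) + ε • A.unit := by
    refine abs_le'.2 ⟨hup.trans ?_, hlo.trans ?_⟩
    · exact add_le_add_left (le_add_of_nonneg_right (negPart_nonneg _)) _
    · exact add_le_add_left (le_add_of_nonneg_left (posPart_nonneg _)) _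
  set m' := (a - s • A.unit)⁺ + (a - (r - ε) • A.unit)⁻ with hm'
  have hm'M : m' ∈ M.1 := M.1.add_mem hs hlo_mem
  have hkε : k * ε = 1 / 2 := by rw [hε]; field_simp
  have hfin : (1 / 2 : ℝ) • A.unit ≤ m + k • m' := by
    have h1 : A.unit ≤ m + (k • m' + (1 / 2 : ℝ) • A.unit) := by
      refine h.trans (add_le_add_right ?_ m)
      refine (smul_le_smul_of_nonneg_left habs hk.le).trans_eq ?_
      rw [smul_add, smul_smul, hkε]
    have h2 : A.unit - (1 / 2 : ℝ) • A.unit ≤ m + k • m' := by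
      rw [sub_le_iff_le_add]
      simpa [add_assoc] using h1
    refine le_trans (le_of_eq ?_) h2
    module
  have hmem : (1 / 2 : ℝ) • A.unit ∈ M.1 := by
    refine M.mem_of_le (M.1.add_mem hm (M.1.smul_mem k hm'M)) ?_
    rwa [abs_of_nonneg (smul_nonneg (by norm_num) A.unit_nonneg)]
  have := M.unit_smul hmem
  norm_num at this

/-- The value `ν_A(a)(M)`: the unique real `r` with `a - r u ∈ M`. -/
noncomputable def yosidaValue (a : A) (M : YosidaSpace A) : ℝ := (M.exists_value a).choose

theorem yosidaValue_spec (a : A) (M : YosidaSpace A) : a - yosidaValue a M • A.unit ∈ M.1 :=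
  (M.exists_value a).choose_spec

theorem yosidaValue_eq {a : A} {M : YosidaSpace A} {r : ℝ} (h : a - r • A.unit ∈ M.1) :
    yosidaValue a M = r := by
  have h1 := M.1.sub_mem h (yosidaValue_spec a M)
  have h2 : (yosidaValue a M - r) • A.unit ∈ M.1 := by
    convert h1 using 1
    module
  exact sub_eq_zero.1 (M.unit_smul h2)

theorem yosidaValue_eq_zero {a : A} {M : YosidaSpace A} : yosidaValue a M = 0 ↔ a ∈ M.1 := by
  refine ⟨fun h => ?_, fun h => yosidaValue_eq (by simpa using h)⟩
  simpa [h] using yosidaValue_spec a M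

theorem yosidaValue_add (a b : A) (M : YosidaSpace A) :
    yosidaValue (a + b) M = yosidaValue a M + yosidaValue b M := by
  refine yosidaValue_eq ?_
  convert M.1.add_mem (yosidaValue_spec a M) (yosidaValue_spec b M) using 1
  module

theorem yosidaValue_smul (r : ℝ) (a : A) (M : YosidaSpace A) :
    yosidaValue (r • a) M = r * yosidaValue a M := by
  refine yosidaValue_eq ?_
  convert M.1.smul_mem r (yosidaValue_spec a M) using 1
  module

theorem yosidaValue_unit (M : YosidaSpace A) : yosidaValue A.unit M = 1 :=
  yosidaValue_eq (by simp)

theorem yosidaValue_neg (a : A) (M : YosidaSpace A) :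
    yosidaValue (-a) M = -yosidaValue a M := by
  have := yosidaValue_smul (-1) a M
  simpa using this

theorem smul_unit_sup (r s : ℝ) : (r ⊔ s) • A.unit = r • A.unit ⊔ s • A.unit := by
  have key : ∀ r s : ℝ, r ≤ s → r • A.unit ≤ s • A.unit := by
    intro r s h
    have := smul_nonneg (sub_nonneg.2 h) A.unit_nonneg
    rwa [sub_smul, sub_nonneg] at this
  rcases le_total r s with h | h
  · rw [sup_eq_right.2 h, sup_eq_right.2 (key r s h)]
  · rw [sup_eq_left.2 h, sup_eq_left.2 (key s r h)]

theorem yosidaValue_sup (a b : A) (M : YosidaSpace A) :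
    yosidaValue (a ⊔ b) M = yosidaValue a M ⊔ yosidaValue b M := by
  refine yosidaValue_eq ?_
  rw [smul_unit_sup]
  set x := yosidaValue a M • A.unit
  set y := yosidaValue b M • A.unit
  have h1 : a ⊔ b - x ⊔ b ∈ M.1 :=
    M.solid (yosidaValue_spec a M) (abs_sup_sub_sup_le_abs a x b)
  have h2 : x ⊔ b - x ⊔ y ∈ M.1 := by
    refine M.solid (yosidaValue_spec b M) ?_
    rw [sup_comm x b, sup_comm x y]
    exact abs_sup_sub_sup_le_abs b y x
  convert M.1.add_mem h1 h2 using 1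
  abel

theorem yosidaValue_inf (a b : A) (M : YosidaSpace A) :
    yosidaValue (a ⊓ b) M = yosidaValue a M ⊓ yosidaValue b M := by
  have h1 : a ⊓ b = -(-a ⊔ -b) := by rw [neg_sup, neg_neg, neg_neg]
  rw [h1, yosidaValue_neg, yosidaValue_sup, yosidaValue_neg, yosidaValue_neg, neg_sup, neg_neg,
    neg_neg]

theorem isOpen_coz (a : A) : IsOpen {M : YosidaSpace A | yosidaValue a M ≠ 0} := by
  refine TopologicalSpace.isOpen_generateFrom_of_mem ⟨a, ?_⟩
  ext M
  exact yosidaValue_eq_zero.symm.not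

theorem isOpen_lt_yosidaValue (a : A) (t : ℝ) :
    IsOpen {M : YosidaSpace A | t < yosidaValue a M} := by
  convert isOpen_coz ((a + (-t) • A.unit) ⊔ (0 : ℝ) • A.unit) using 1
  ext M
  simp only [Set.mem_ofPred_eq, yosidaValue_sup, yosidaValue_add, yosidaValue_smul,
    yosidaValue_unit, mul_one, ne_eq, sup_eq_right, not_le]
  constructor
  · intro h
    linarith
  · intro h
    linarith

theorem continuous_yosidaValue (a : A) : Continuous (yosidaValue a) := by
  rw [OrderTopology.topology_eq_generate_intervals (α := ℝ), continuous_generateFrom_iff]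
  rintro s ⟨t, rfl | rfl⟩
  · exact isOpen_lt_yosidaValue a t
  · convert isOpen_lt_yosidaValue (-a) (-t) using 1
    ext M
    simp [yosidaValue_neg]

instance (A : WStar.{u}) : T2Space (YosidaSpace A) := by
  refine ⟨fun M N hMN => ?_⟩
  have hnot : ¬ M.1 ≤ N.1 := fun h =>
    hMN (Subtype.ext (le_antisymm h (M.2.2 N.2.1 h)))
  obtain ⟨a, haM, haN⟩ := SetLike.not_le_iff_exists.1 hnot
  have hne : yosidaValue a M ≠ yosidaValue a N := by
    rw [yosidaValue_eq_zero.2 haM]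
    exact fun h => haN (yosidaValue_eq_zero.1 h.symm)
  exact separated_by_continuous (continuous_yosidaValue a) hne

theorem abs_yosidaValue_le {a : A} {n : ℕ} (h : |a| ≤ n • A.unit) (M : YosidaSpace A) :
    yosidaValue a M ∈ Set.Icc (-(n : ℝ)) n := by
  have hv : yosidaValue (|a| ⊔ (n : ℝ) • A.unit) M = n := by
    rw [sup_eq_right.2 (by rwa [Nat.cast_smul_eq_nsmul]), yosidaValue_smul, yosidaValue_unit,
      mul_one]
  have habs : yosidaValue |a| M = |yosidaValue a M| := by
    change yosidaValue (a ⊔ -a) M = _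
    rw [yosidaValue_sup, yosidaValue_neg]
    rfl
  rw [yosidaValue_sup, habs, yosidaValue_smul, yosidaValue_unit, mul_one] at hv
  exact abs_le.1 (sup_eq_right.1 hv)

instance (A : WStar.{u}) : CompactSpace (YosidaSpace A) := by
  refine ⟨isCompact_iff_ultrafilter_le_nhds.2 fun F _ => ?_⟩
  have hlim : ∀ a : A, ∃ r : ℝ, Filter.Tendsto (yosidaValue a) F (nhds r) := by
    intro a
    obtain ⟨n, hn⟩ := A.strong_unit a
    obtain ⟨r, -, hr⟩ := (isCompact_Icc (a := -(n : ℝ)) (b := n)).ultrafilter_le_nhds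
      (F.map (yosidaValue a)) (by
        rw [Filter.le_principal_iff]
        exact Filter.mem_map.2 (Filter.univ_mem' fun M => abs_yosidaValue_le hn M))
    exact ⟨r, hr⟩
  choose φ hφ using hlim
  have huniq : ∀ {a : A} {r : ℝ}, Filter.Tendsto (yosidaValue a) F (nhds r) → φ a = r :=
    fun h => tendsto_nhds_unique (hφ _) h
  have hadd : ∀ a b, φ (a + b) = φ a + φ b := fun a b => huniq <| by
    simpa only [← yosidaValue_add] using (hφ a).add (hφ b)
  have hsmul : ∀ (r : ℝ) a, φ (r • a) = r * φ a := fun r a => huniq <| by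
    simpa only [← yosidaValue_smul] using (hφ a).const_mul r
  have hsup : ∀ a b, φ (a ⊔ b) = φ a ⊔ φ b := fun a b => huniq <| by
    simpa only [← yosidaValue_sup] using (hφ a).sup_nhds (hφ b)
  have hunit : φ A.unit = 1 := huniq <| by
    have h : (yosidaValue A.unit : YosidaSpace A → ℝ) = fun _ => 1 := funext yosidaValue_unit
    rw [h]
    exact tendsto_const_nhds
  have habs : ∀ a, φ |a| = |φ a| := fun a => by
    have h2 : φ (-a) = -φ a := by simpa using hsmul (-1) a
    change φ (a ⊔ -a) = _
    rw [hsup, h2]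
    rfl
  let I : Submodule ℝ A :=
    { carrier := {a | φ a = 0}
      zero_mem' := by simpa using hsmul 0 0
      add_mem' := fun {a b} ha hb => by
        simp only [Set.mem_ofPred_eq] at ha hb ⊢
        rw [hadd, ha, hb, add_zero]
      smul_mem' := fun r a ha => by
        simp only [Set.mem_ofPred_eq] at ha ⊢
        rw [hsmul, ha, mul_zero] }
  have hI : Maximal (IsUnitFreeIdeal A) I := by
    refine ⟨⟨?_, ?_⟩, ?_⟩
    · intro x hx y hy
      have hx' : φ x = 0 := hx
      have h1 : φ |x| = φ |y| ⊔ φ |x| := by rw [← hsup, sup_eq_right.2 hy]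
      have h2 : |φ y| ≤ 0 := by
        have h3 : φ |y| ≤ φ |x| := by rw [h1]; exact le_sup_left
        rwa [habs, habs, hx', abs_zero] at h3
      exact abs_eq_zero.1 (le_antisymm h2 (abs_nonneg _))
    · intro h
      have h' : φ A.unit = 0 := h
      rw [hunit] at h'
      exact one_ne_zero h'
    · intro J hJ hIJ x hx
      have h1 : x - φ x • A.unit ∈ I := by
        change φ _ = 0
        have h2 : x - φ x • A.unit = x + (-φ x) • A.unit := by module
        rw [h2, hadd, hsmul, hunit]
        ring
      have h3 : φ x • A.unit ∈ J := by
        have := J.sub_mem hx (hIJ h1)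
        simpa using this
      change φ x = 0
      by_contra hne
      refine hJ.2 ?_
      have := J.smul_mem (φ x)⁻¹ h3
      rwa [smul_smul, inv_mul_cancel₀ hne, one_smul] at this
  obtain ⟨P, hP⟩ : ∃ P : YosidaSpace A, P.1 = I := ⟨⟨I, hI⟩, rfl⟩
  refine ⟨P, Set.mem_univ _, ?_⟩
  have hF : Filter.Tendsto (fun M : YosidaSpace A => M) F (nhds P) := by
    rw [TopologicalSpace.tendsto_nhds_generateFrom_iff]
    rintro _ ⟨a, rfl⟩ ha
    have hne : φ a ≠ 0 := fun h => ha (by rw [hP]; exact h)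
    filter_upwards [(hφ a).eventually_ne hne] with M hM
    exact fun h => hM (yosidaValue_eq_zero.2 h)
  exact hF

end Yosida

/-- The Yosida space `YA` as a compact Hausdorff space. -/
def yosida (A : WStar.{u}) : CompHaus.{u} := CompHaus.of (YosidaSpace A)

/-- The Yosida morphism `ν_A : A → C(YA)`, `ν_A(a)(M) = r` iff `a - r u ∈ M`. -/
noncomputable def nu (A : WStar.{u}) : Hom A (ofCont (yosida A)) where
  toFun a := (⟨yosidaValue a, continuous_yosidaValue a⟩ : C(YosidaSpace A, ℝ))
  map_add' a b := ContinuousMap.ext fun M => yosidaValue_add a b M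
  map_smul' r a := ContinuousMap.ext fun M => yosidaValue_smul r a M
  map_sup' a b := ContinuousMap.ext fun M => yosidaValue_sup a b M
  map_inf' a b := ContinuousMap.ext fun M => yosidaValue_inf a b M
  map_unit' := ContinuousMap.ext fun M => yosidaValue_unit M

/-! ## The operators `μ(c)` and `u` -/

/-- `μ(c)A = C(cYA)`, with `μ(c)_A : A → C(YA) → C(cYA)`, `a ↦ ν_A(a) ∘ c_{YA}`. -/
noncomputable def mu (c : CoverAssignment.{u}) : ExtensionAssignment.{u} := fun A =>
  { obj := ofCont (c (yosida A)).space
    hom := (ofContMap (c (yosida A)).map).comp (nu A) }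

/-- The uniform completion operator: `uA = C(YA)` and `u_A = ν_A`. -/
noncomputable def uniformCompletion : ExtensionAssignment.{u} := fun A =>
  { obj := ofCont (yosida A)
    hom := nu A }

end WStar

/-! ## Irreducible maps of compact Hausdorff spaces -/

/-! The theorem rests on the contravariant duality between `W*`-morphisms `f : A → B` and continuous
maps `yosidaMap f : YB → YA`. Two representation facts drive it: elements of `A` are determined by
their values on `YA` (`exists_yosidaValue_ne_zero`, where the Archimedean axiom enters), and they
separate closed sets from points (`exists_value_separating`, from the density of `ν_A(A)`).
Consequently injectivity of `f` is surjectivity of its dual, and essentiality is irreducibility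
(`isEssential_iff_isPerfectIrreducible`). Each essential extension of `A` thus yields a cover of
`YA`; conversely, a cover `Y → YA` yields the essential extension `A → C(YA) → C(Y)`, since `X ≅
Y(C(X))`.

Minimality of `cYA` among covers in `fix(c)` therefore becomes minimality of `C(cYA)` among
extensions in `fix(μ(c))`, because `μ(c)_B` is an isomorphism only if `c_{YB}` is a homeomorphism
and `ν_B` is onto. Likewise, maximality of `gYA` becomes maximality of `C(gYA)`, so `μ(g)` satisfies
the defining property of `e`. The Gleason cover is a minimal closed subset, still mapping onto `X`,
of a projective space above `X`.

That a maximum operator is a covering or hull operator is formal, given uniqueness of comparison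
morphisms (`IsPerfectIrreducible.eq_of_comp_eq`, `Hom.IsEssential.hom_eq`). -/

theorem IsPerfectIrreducible.of_irreducible {Y X : Type*} [TopologicalSpace Y] [TopologicalSpace X]
    [CompactSpace Y] [T2Space X] {f : Y → X} (hf : Continuous f) (hs : Function.Surjective f)
    (hi : ∀ F : Set Y, IsClosed F → f '' F = Set.univ → F = Set.univ) :
    IsPerfectIrreducible f where
  continuous := hf
  isClosedMap := hf.isClosedMap
  isCompact_fiber _ := (isClosed_singleton.preimage hf).isCompact
  surjective := hs
  irreducible F hF hne h := hne (hi F hF h)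

section Irreducible

variable {Y Z X : Type*} [TopologicalSpace Y] [TopologicalSpace Z] [TopologicalSpace X]

theorem IsPerfectIrreducible.eq_univ {f : Y → X} (hf : IsPerfectIrreducible f) {F : Set Y}
    (hF : IsClosed F) (h : f '' F = Set.univ) : F = Set.univ := by
  by_contra hne
  exact hf.irreducible F hF hne h

/-- The range of `q` is closed by compactness and `p` maps it onto `X`, so irreducibility of `p`
makes it everything. This is the topological counterpart of the cancellation property defining
essential embeddings. -/
theorem IsPerfectIrreducible.surjective_of_comp [CompactSpace Y] [T2Space Z] {p : Z → X}
    {q : Y → Z} (hp : IsPerfectIrreducible p) (hq : Continuous q)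
    (h : Function.Surjective (p ∘ q)) : Function.Surjective q := by
  rw [← Set.range_eq_univ]
  refine hp.eq_univ (isCompact_range hq).isClosed ?_
  rw [← Set.range_comp, h.range_eq]

theorem IsPerfectIrreducible.of_homeomorph [CompactSpace Y] [T2Space X] (e : Y ≃ₜ X) :
    IsPerfectIrreducible e :=
  .of_irreducible e.continuous e.surjective fun F _ h => by
    rw [← e.injective.preimage_image F, h, Set.preimage_univ]

theorem IsPerfectIrreducible.comp [CompactSpace Y] [T2Space X] {p : Z → X} {q : Y → Z}
    (hp : IsPerfectIrreducible p) (hq : IsPerfectIrreducible q) :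
    IsPerfectIrreducible (p ∘ q) :=
  .of_irreducible (hp.continuous.comp hq.continuous) (hp.surjective.comp hq.surjective)
    fun F hF h => hq.eq_univ hF <| hp.eq_univ (hq.isClosedMap F hF) (by rwa [← Set.image_comp])

/-- Makes a comparison map between two covers of `X` a cover in its own right. -/
theorem IsPerfectIrreducible.of_comp [CompactSpace Y] [T2Space Z] {p : Z → X} {q : Y → Z}
    (hp : IsPerfectIrreducible p) (hq : Continuous q) (h : IsPerfectIrreducible (p ∘ q)) :
    IsPerfectIrreducible q := by
  refine .of_irreducible hq (hp.surjective_of_comp hq h.surjective) fun F hF hFq => ?_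
  refine h.eq_univ hF ?_
  rw [Set.image_comp, hFq, Set.image_univ, hp.surjective.range_eq]

/-- Comparison maps between covers are unique. -/
theorem IsPerfectIrreducible.eq_of_comp_eq [CompactSpace Y] [T2Space Z] {p : Z → X}
    {f g : Y → Z} (hp : IsPerfectIrreducible p) (hf : Continuous f) (hg : Continuous g)
    (hpf : IsPerfectIrreducible (p ∘ f)) (hfg : p ∘ f = p ∘ g) : f = g := by
  funext y
  by_contra hne
  obtain ⟨U, V, hU, hV, hyU, hyV, hUV⟩ := t2_separation hne
  have hW : IsOpen (f ⁻¹' U ∩ g ⁻¹' V) := (hU.preimage hf).inter (hV.preimage hg)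
  -- The open set around `y` is nonempty, so by irreducibility its complement does not map onto `X`:
  -- some `x` has its whole fibre in `Y` inside the open set.
  obtain ⟨x, hx⟩ : ∃ x, x ∉ (p ∘ f) '' (f ⁻¹' U ∩ g ⁻¹' V)ᶜ := by
    by_contra! hall
    have := hpf.eq_univ hW.isClosed_compl (Set.eq_univ_of_forall hall)
    exact (this ▸ Set.mem_univ y : y ∈ (f ⁻¹' U ∩ g ⁻¹' V)ᶜ) ⟨hyU, hyV⟩
  have hmem : ∀ y, p (f y) = x → f y ∈ U ∧ g y ∈ V := fun y hy => by
    by_contra hn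
    exact hx ⟨y, hn, hy⟩
  obtain ⟨z, hz⟩ := hp.surjective x
  obtain ⟨y₁, rfl⟩ := hp.surjective_of_comp hf hpf.surjective z
  -- Since `p ∘ f = p ∘ g`, the point `y₂` also lies over `x`; so `f y₁ = g y₂` belongs to both `U`
  -- and `V`.
  obtain ⟨y₂, hy₂⟩ := hp.surjective_of_comp hg (hfg ▸ hpf.surjective) (f y₁)
  have h₂ : p (f y₂) = x := by
    rw [show p (f y₂) = p (g y₂) from congrFun hfg y₂, hy₂, hz]
  exact Set.disjoint_left.1 hUV (hmem y₁ hz).1 (hy₂ ▸ (hmem y₂ h₂).2)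

end Irreducible

/-! ## Covering operators -/

/-- A cover `p` of `X` with a section is a homeomorphism. -/
theorem IsPerfectIrreducible.isHomeomorph_of_section {Z X : Type*} [TopologicalSpace Z]
    [TopologicalSpace X] [CompactSpace Z] [T2Space Z] [CompactSpace X] [T2Space X] {p : Z → X}
    (hp : IsPerfectIrreducible p) {s : X → Z} (hs : Continuous s)
    (h : Function.RightInverse s p) : IsHomeomorph p := by
  rw [isHomeomorph_iff_continuous_bijective]
  have hsurj : Function.Surjective s := hp.surjective_of_comp hs fun x => ⟨x, h x⟩
  refine ⟨hp.continuous, fun z₁ z₂ hz => ?_, hp.surjective⟩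
  obtain ⟨x₁, rfl⟩ := hsurj z₁
  obtain ⟨x₂, rfl⟩ := hsurj z₂
  rw [h x₁, h x₂] at hz
  rw [hz]

/-- Via `e`, the space `W` is a cover of `Z` lying in `fix(c)`; minimality of `cZ` then supplies a
section of `c_Z`. -/
theorem IsCoveringOperator.mem_fix_of_homeomorph {c : CoverAssignment.{u}}
    (hc : IsCoveringOperator c) {W Z : CompHaus.{u}} (hW : W ∈ c.fix) (e : W ≃ₜ Z) :
    Z ∈ c.fix := by
  obtain ⟨f, hf⟩ := (hc Z).2 ⟨W, ⟨e, e.continuous⟩, .of_homeomorph e⟩ hW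
  refine (c Z).isCover.isHomeomorph_of_section (f.continuous.comp e.symm.continuous) fun z => ?_
  have := DFunLike.congr_fun hf (e.symm z)
  simpa using this.symm

/-- Map a projective compact space `D` onto `X` and use Zorn's lemma to get a closed `E ⊆ D` minimal
among those still mapping onto `X`; minimality is irreducibility. For any cover of `X`, projectivity
lifts `D → X` through it, and the lift restricted to `E` is the required comparison map. -/
theorem exists_isGleasonOperator : ∃ g : CoverAssignment.{u}, IsGleasonOperator g := by
  suffices h : ∀ X : CompHaus.{u}, ∃ Q : CompCover X, ∀ P : CompCover X, P.le Q by
    choose g hg using h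
    exact ⟨g, hg⟩
  intro X
  have hX : T2Space X := inferInstance
  have hX' : T1Space X := hX.t1Space
  obtain ⟨D, _, _, _, π, hπ, hπs, hproj⟩ : ∃ (D : Type u) (_ : TopologicalSpace D)
      (_ : CompactSpace D) (_ : T2Space D) (π : D → X), Continuous π ∧ Function.Surjective π ∧
        CompactT2.Projective D := by
    let π := CompHaus.presentation.π X
    exact ⟨X.presentation, inferInstance, inferInstance, inferInstance, π, π.hom.hom.continuous,
      (CompHaus.epi_iff_surjective _).1 inferInstance,
      CompactT2.ExtremallyDisconnected.projective⟩
  obtain ⟨E, hE, hEs, hEi⟩ := exists_compact_surjective_zorn_subset hπ hπs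
  let ρ : C(E, X) := ⟨fun x => π x, hπ.comp continuous_subtype_val⟩
  refine ⟨⟨CompHaus.of E, ρ, .of_irreducible ρ.continuous (fun x => ?_) fun F hF h => ?_⟩,
    fun P => ?_⟩
  · obtain ⟨d, hd, rfl⟩ := hEs ▸ Set.mem_univ x
    exact ⟨⟨d, hd⟩, rfl⟩
  · by_contra hne
    exact hEi F hne hF h
  · obtain ⟨l, hl, hl'⟩ := hproj hπ P.map.continuous P.isCover.surjective
    exact ⟨⟨fun x : E => l x, hl.comp continuous_subtype_val⟩,
      ContinuousMap.ext fun x : E => (congrFun hl' x.1).symm⟩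

/-- The composite `ggX → gX → X` is a cover, so maximality gives `s : gX → ggX` over `X`. Uniqueness
of comparison maps makes `s` a section of `ggX → gX`, which is hence a homeomorphism. For
minimality, `gX` is a cover of any cover `P` of `X`, so `gP` maps to `gX` over `P`; when `gP ≅ P`
this is a map `P → gX`. -/
theorem IsGleasonOperator.isCoveringOperator {g : CoverAssignment.{u}} (hg : IsGleasonOperator g) :
    IsCoveringOperator g := by
  intro X
  constructor
  · have hcomp := (g X).isCover.comp (g (g X).space).isCover
    obtain ⟨s, hs⟩ := hg X ⟨_, (g X).map.comp (g (g X).space).map, hcomp⟩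
    refine (g (g X).space).isCover.isHomeomorph_of_section s.continuous ?_
    refine congrFun ((g X).isCover.eq_of_comp_eq (g := id)
      ((g (g X).space).map.continuous.comp s.continuous) continuous_id ?_ ?_)
    · have h : (g X).map ∘ (fun x => (g (g X).space).map (s x)) = (g X).map :=
        funext fun x => (DFunLike.congr_fun hs x).symm
      rw [h]
      exact (g X).isCover
    · exact funext fun x => (DFunLike.congr_fun hs x).symm
  · intro P hP
    obtain ⟨q, hq⟩ := hg X P
    have hqc : IsPerfectIrreducible q := P.isCover.of_comp q.continuous (by
      rw [← ContinuousMap.coe_comp, ← hq]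
      exact (g X).isCover)
    obtain ⟨r, hr⟩ := hg P.space ⟨_, q, hqc⟩
    let e := hP.homeomorph
    refine ⟨r.comp ⟨e.symm, e.symm.continuous⟩, ContinuousMap.ext fun y => ?_⟩
    have h1 : q (r (e.symm y)) = y :=
      (DFunLike.congr_fun hr (e.symm y)).symm.trans (e.apply_symm_apply y)
    have h2 := DFunLike.congr_fun hq (r (e.symm y))
    exact (congrArg P.map h1.symm).trans h2.symm

theorem isCoveringOperator_idCover : IsCoveringOperator idCover.{u} := fun _ =>
  ⟨IsHomeomorph.id, fun P _ => ⟨P.map, rfl⟩⟩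

namespace WStar

/-! ## Morphisms of `W*` -/

theorem Hom.ext {A B : WStar.{u}} {f g : Hom A B} (h : ∀ a, f a = g a) : f = g := by
  obtain ⟨f, _, _, _⟩ := f
  obtain ⟨g, _, _, _⟩ := g
  obtain rfl : f = g := LinearMap.ext h
  rfl

theorem Hom.congr_apply {A B : WStar.{u}} {f g : Hom A B} (h : f = g) (a : A) : f a = g a := by
  rw [h]

/-- The inverse of a bijective morphism. -/
noncomputable def Hom.inverse {A B : WStar.{u}} (f : Hom A B) (hf : Function.Bijective f) :
    Hom B A where
  toLinearMap := (LinearEquiv.ofBijective f.toLinearMap hf).symm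
  map_sup' a b := hf.1 <| by
    have h : ∀ b, f ((LinearEquiv.ofBijective f.toLinearMap hf).symm b) = b :=
      (LinearEquiv.ofBijective f.toLinearMap hf).apply_symm_apply
    exact (h _).trans (((f.map_sup' _ _).trans (congrArg₂ _ (h a) (h b))).symm)
  map_inf' a b := hf.1 <| by
    have h : ∀ b, f ((LinearEquiv.ofBijective f.toLinearMap hf).symm b) = b :=
      (LinearEquiv.ofBijective f.toLinearMap hf).apply_symm_apply
    exact (h _).trans (((f.map_inf' _ _).trans (congrArg₂ _ (h a) (h b))).symm)
  map_unit' := hf.1 <|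
    ((LinearEquiv.ofBijective f.toLinearMap hf).apply_symm_apply _).trans f.map_unit'.symm

theorem Hom.apply_inverse {A B : WStar.{u}} (f : Hom A B) (hf : Function.Bijective f) (b : B) :
    f (f.inverse hf b) = b :=
  (LinearEquiv.ofBijective f.toLinearMap hf).apply_symm_apply b

theorem Hom.inverse_apply {A B : WStar.{u}} (f : Hom A B) (hf : Function.Bijective f) (a : A) :
    f.inverse hf (f a) = a :=
  (LinearEquiv.ofBijective f.toLinearMap hf).symm_apply_apply a

theorem Hom.isIso_iff_bijective {A B : WStar.{u}} {f : Hom A B} :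
    f.IsIso ↔ Function.Bijective f := by
  constructor
  · rintro ⟨g, hgf, hfg⟩
    exact ⟨Function.LeftInverse.injective (g := g) (Hom.congr_apply hgf),
      Function.RightInverse.surjective (g := g) (Hom.congr_apply hfg)⟩
  · intro hf
    exact ⟨f.inverse hf, Hom.ext (f.inverse_apply hf), Hom.ext (f.apply_inverse hf)⟩

theorem Hom.injective_iff {A B : WStar.{u}} (f : Hom A B) :
    Function.Injective f ↔ ∀ a, f a = 0 → a = 0 :=
  injective_iff_map_eq_zero f.toLinearMap

theorem Hom.IsEssential.comp {A B C : WStar.{u}} {g : Hom B C} {f : Hom A B} (hg : g.IsEssential)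
    (hf : f.IsEssential) : (g.comp f).IsEssential :=
  ⟨hg.1.comp hf.1, fun D k hk => hg.2 D k (hf.2 D (k.comp g) hk)⟩

theorem Hom.IsEssential.of_comp {A B C : WStar.{u}} {g : Hom B C} {f : Hom A B}
    (h : (g.comp f).IsEssential) (hf : f.IsEssential) : g.IsEssential :=
  ⟨hf.2 C g h.1, fun D k hk => h.2 D k (hk.comp hf.1)⟩

/-! ## The Yosida representation -/

theorem yosidaValue_ext {A : WStar.{u}} {M N : YosidaSpace A}
    (h : ∀ a, yosidaValue a M = yosidaValue a N) : M = N := by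
  refine Subtype.ext (SetLike.ext fun a => ?_)
  rw [← yosidaValue_eq_zero, ← yosidaValue_eq_zero, h]

/-- Every ideal that does not contain the unit is contained in a maximal one. -/
theorem exists_le_yosidaSpace {A : WStar.{u}} {I : Submodule ℝ A} (hI : IsUnitFreeIdeal A I) :
    ∃ M : YosidaSpace A, I ≤ M.1 := by
  have hub : ∀ c ⊆ {J | IsUnitFreeIdeal A J}, IsChain (· ≤ ·) c → ∀ J ∈ c,
      ∃ K ∈ {J | IsUnitFreeIdeal A J}, ∀ L ∈ c, L ≤ K := by
    intro c hc hchain J hJ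
    have hmem : ∀ x, x ∈ sSup c ↔ ∃ K ∈ c, x ∈ K := fun x =>
      Submodule.mem_sSup_of_directed ⟨J, hJ⟩ hchain.directedOn
    refine ⟨sSup c, ⟨?_, ?_⟩, fun K hK => le_sSup hK⟩
    · intro x hx y hxy
      obtain ⟨K, hK, hxK⟩ := (hmem x).1 hx
      exact (hmem y).2 ⟨K, hK, (hc hK).1 hxK hxy⟩
    · intro h
      obtain ⟨K, hK, hu⟩ := (hmem _).1 h
      exact (hc hK).2 hu
  obtain ⟨M, hIM, hM⟩ := zorn_le_nonempty₀ _ hub I hI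
  exact ⟨⟨M, hM⟩, hIM⟩

/-- The ideal generated by a nonnegative element. -/
def principalIdeal {A : WStar.{u}} (c : A) (hc : 0 ≤ c) : Submodule ℝ A where
  carrier := {x | ∃ n : ℕ, |x| ≤ n • c}
  zero_mem' := ⟨0, by simp⟩
  add_mem' := by
    rintro x y ⟨m, hm⟩ ⟨n, hn⟩
    exact ⟨m + n, by rw [add_smul]; exact (abs_add_le x y).trans (add_le_add hm hn)⟩
  smul_mem' := by
    rintro r x ⟨n, hn⟩
    obtain ⟨k, hk⟩ := exists_nat_ge |r|
    have key : ∀ (s : ℝ) (y : A), 0 ≤ s → s ≤ k → y ≤ n • c → s • y ≤ (k * n) • c := by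
      intro s y hs hsk hy
      have h1 := smul_le_smul_of_nonneg_left hy hs
      have h2 := smul_nonneg (sub_nonneg.2 hsk) (nsmul_nonneg hc n)
      rw [sub_smul, sub_nonneg, Nat.cast_smul_eq_nsmul, smul_smul] at h2
      exact h1.trans h2
    have h₁ := (le_abs_self x).trans hn
    have h₂ := (neg_le_abs x).trans hn
    refine ⟨k * n, abs_le'.2 ?_⟩
    rcases le_total 0 r with hr | hr
    · rw [abs_of_nonneg hr] at hk
      exact ⟨key r x hr hk h₁, by rw [← smul_neg]; exact key r (-x) hr hk h₂⟩
    · rw [abs_of_nonpos hr] at hk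
      have hr' := neg_nonneg.2 hr
      exact ⟨by rw [← neg_smul_neg]; exact key (-r) (-x) hr' hk h₂,
        by rw [← neg_smul]; exact key (-r) x hr' hk h₁⟩

/-- Disjointness from `c` is inherited by multiples of `c`. -/
theorem inf_nsmul_eq_zero {A : WStar.{u}} {b c : A} (hb : 0 ≤ b) (hc : 0 ≤ c) (h : b ⊓ c = 0)
    (n : ℕ) : b ⊓ n • c = 0 := by
  refine le_antisymm ?_ (le_inf hb (nsmul_nonneg hc n))
  rcases Nat.eq_zero_or_pos n with rfl | hn
  · simp
  have hn' : (0 : ℝ) < n := Nat.cast_pos.2 hn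
  have h1 : (1 : ℝ) ≤ n := by exact_mod_cast hn
  set d := b ⊓ n • c
  have hd : 0 ≤ d := le_inf hb (nsmul_nonneg hc n)
  have e1 : (n : ℝ)⁻¹ • d ≤ b := by
    have := smul_nonneg (sub_nonneg.2 (inv_le_one_of_one_le₀ h1)) hd
    rw [sub_smul, sub_nonneg, one_smul] at this
    exact this.trans inf_le_left
  have e2 : (n : ℝ)⁻¹ • d ≤ c := by
    have := smul_le_smul_of_nonneg_left (inf_le_right : d ≤ n • c) (inv_nonneg.2 hn'.le)
    refine this.trans_eq ?_
    rw [← Nat.cast_smul_eq_nsmul ℝ n c, smul_smul, inv_mul_cancel₀ hn'.ne', one_smul]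
  have e3 := smul_le_smul_of_nonneg_left ((le_inf e1 e2).trans h.le) hn'.le
  rwa [smul_smul, mul_inv_cancel₀ hn'.ne', one_smul, smul_zero] at e3

/-- In an Archimedean vector lattice a nonzero element is nonzero at a point of the Yosida
space. -/
theorem exists_yosidaValue_ne_zero {A : WStar.{u}} {a : A} (ha : a ≠ 0) :
    ∃ M : YosidaSpace A, yosidaValue a M ≠ 0 := by
  obtain ⟨n, hn⟩ : ∃ n : ℕ, ¬ n • |a| ≤ A.unit := by
    by_contra! h
    exact ha (le_antisymm ((le_abs_self a).trans_eq (A.archimedean _ _ (abs_nonneg a) h))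
      (neg_nonpos.1 ((neg_le_abs a).trans_eq (A.archimedean _ _ (abs_nonneg a) h))))
  set x := n • |a| - A.unit with hx
  -- If the unit were below a multiple of `x⁻`, then so would be `x⁺`; as `x⁺` is disjoint from
  -- `x⁻`, this forces `x⁺ = 0`, that is `n • |a| ≤ A.unit`.
  have hI : IsUnitFreeIdeal A (principalIdeal x⁻ (negPart_nonneg x)) := by
    refine ⟨?_, ?_⟩
    · rintro y ⟨k, hk⟩ z hz
      exact ⟨k, le_trans hz hk⟩
    · rintro ⟨k, hk⟩
      obtain ⟨m, hm⟩ := A.strong_unit x⁺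
      rw [abs_of_nonneg (posPart_nonneg x)] at hm
      rw [abs_of_nonneg A.unit_nonneg] at hk
      have h1 : x⁺ ≤ (m * k) • x⁻ := by
        rw [mul_smul]
        exact hm.trans (nsmul_le_nsmul_right hk m)
      have h2 := inf_nsmul_eq_zero (posPart_nonneg x) (negPart_nonneg x)
        (posPart_inf_negPart_eq_zero x) (m * k)
      rw [inf_eq_left.2 h1, posPart_eq_zero] at h2
      exact hn (sub_nonpos.1 h2)
  obtain ⟨M, hM⟩ := exists_le_yosidaSpace hI
  refine ⟨M, fun h0 => ?_⟩
  have hmem : x⁻ ∈ M.1 := hM ⟨1, by rw [one_smul, abs_of_nonneg (negPart_nonneg x)]⟩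
  have ha' : |a| ∈ M.1 := M.abs_mem (yosidaValue_eq_zero.1 h0)
  -- The unit is at most `x⁻ + n • |a|`, so `M` cannot contain both `x⁻` and `a`.
  refine M.2.1.2 (M.mem_of_le (M.1.add_mem hmem (M.1.smul_mem (n : ℝ) ha')) ?_)
  rw [abs_of_nonneg A.unit_nonneg, Nat.cast_smul_eq_nsmul]
  have := neg_le_negPart x
  rw [hx, neg_sub, sub_le_iff_le_add] at this
  exact this

/-! ## Values of functions and of elements -/

/-- The value at a point of an element of `C(X)`. -/
def eval {X : CompHaus.{u}} (k : ofCont X) (x : X) : ℝ := (show C(X, ℝ) from k) x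

theorem eval_ext {X : CompHaus.{u}} {k l : ofCont X} (h : ∀ x, eval k x = eval l x) : k = l :=
  ContinuousMap.ext (f := (show C(X, ℝ) from k)) h

theorem eval_zero {X : CompHaus.{u}} (x : X) : eval (0 : ofCont X) x = 0 := rfl

theorem continuous_eval {X : CompHaus.{u}} (k : ofCont X) : Continuous (eval k) :=
  (show C(X, ℝ) from k).continuous

theorem eval_ofContMap {X Y : CompHaus.{u}} (p : C(Y, X)) (k : ofCont X) (y : Y) :
    eval (ofContMap p k) y = eval k (p y) := rfl

/-- The value of `ν_A(a)` at a point of `YA`. -/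
noncomputable def value {A : WStar.{u}} (a : A) (M : yosida A) : ℝ :=
  yosidaValue (A := A) a M

theorem eval_nu {A : WStar.{u}} (a : A) (M : yosida A) : eval (nu A a) M = value a M := rfl

theorem value_zero {A : WStar.{u}} (M : yosida A) : value (0 : A) M = 0 :=
  yosidaValue_eq_zero.2 (show YosidaSpace A from M).1.zero_mem

theorem value_ext {A : WStar.{u}} {M N : yosida A} (h : ∀ a, value a M = value a N) : M = N :=
  yosidaValue_ext (A := A) h

theorem eq_zero_of_value {A : WStar.{u}} {a : A} (h : ∀ M, value a M = 0) : a = 0 := by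
  by_contra hne
  obtain ⟨M, hM⟩ := exists_yosidaValue_ne_zero hne
  exact hM (h M)

theorem nu_injective (A : WStar.{u}) : Function.Injective (nu A) :=
  (nu A).injective_iff.2 fun a ha => eq_zero_of_value fun M => by
    rw [← eval_nu, ha, eval_zero]

theorem eq_of_value {A : WStar.{u}} {a b : A} (h : ∀ M, value a M = value b M) : a = b :=
  nu_injective A (eval_ext h)

/-- The lattice form of Stone–Weierstrass: it suffices to interpolate arbitrary values at any two
points of `YA`. -/
theorem dense_nu (A : WStar.{u}) (k : C(YosidaSpace A, ℝ)) {ε : ℝ} (hε : 0 < ε) :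
    ∃ a : A, ∀ M : YosidaSpace A, |yosidaValue a M - k M| < ε := by
  let ν : A → C(YosidaSpace A, ℝ) := nu A
  have hν : ∀ a M, ν a M = yosidaValue a M := fun _ _ => rfl
  have hL : closure (Set.range ν) = ⊤ := by
    refine ContinuousMap.sublattice_closure_eq_top _ ⟨_, 0, rfl⟩ ?_ ?_ ?_
    · rintro _ ⟨a, rfl⟩ _ ⟨b, rfl⟩
      exact ⟨a ⊓ b, (nu A).map_inf' a b⟩
    · rintro _ ⟨a, rfl⟩ _ ⟨b, rfl⟩
      exact ⟨a ⊔ b, (nu A).map_sup' a b⟩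
    · intro v M N
      by_cases hMN : M = N
      · subst hMN
        refine ⟨_, ⟨v M • A.unit, rfl⟩, ?_, ?_⟩ <;>
          rw [hν, yosidaValue_smul, yosidaValue_unit, mul_one]
      obtain ⟨a, ha⟩ : ∃ a : A, yosidaValue a M ≠ yosidaValue a N := by
        by_contra! h
        exact hMN (yosidaValue_ext h)
      have hd : yosidaValue a M - yosidaValue a N ≠ 0 := sub_ne_zero.2 ha
      -- An affine combination of `a` and the unit takes the prescribed values at `M` and `N`.
      set t := (v M - v N) / (yosidaValue a M - yosidaValue a N)
      have ht : t * (yosidaValue a M - yosidaValue a N) = v M - v N := div_mul_cancel₀ _ hd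
      refine ⟨_, ⟨t • a + (v N - t * yosidaValue a N) • A.unit, rfl⟩, ?_, ?_⟩ <;>
        rw [hν, yosidaValue_add, yosidaValue_smul, yosidaValue_smul, yosidaValue_unit] <;> linarith
  have hk : k ∈ closure (Set.range ν) := by rw [hL]; trivial
  obtain ⟨_, ⟨a, rfl⟩, ha⟩ := Metric.mem_closure_iff.1 hk ε hε
  refine ⟨a, fun M => ?_⟩
  have := (ContinuousMap.dist_apply_le_dist (f := k) (g := ν a) M).trans_lt ha
  rwa [dist_comm, Real.dist_eq] at this

/-- Closed sets and points of the Yosida space are separated by elements of `A`. -/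
theorem exists_value_separating {A : WStar.{u}} {F : Set (yosida A)} (hF : IsClosed F)
    {M : yosida A} (hM : M ∉ F) :
    ∃ a : A, (∀ N ∈ F, value a N = 0) ∧ value a M ≠ 0 := by
  suffices h : ∀ (F : Set (YosidaSpace A)) (M : YosidaSpace A), IsClosed F → M ∉ F →
      ∃ a : A, (∀ N ∈ F, yosidaValue a N = 0) ∧ yosidaValue a M ≠ 0 from h F M hF hM
  clear hF hM M F
  intro F M hF hM
  obtain ⟨k, hk0, hk1, -⟩ := exists_continuous_zero_one_of_isClosed hF (isClosed_singleton (x := M))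
    (Set.disjoint_singleton_right.2 hM)
  -- The approximant of the Urysohn function is below `1/3` on `F` and above `2/3` at `M`, so the
  -- positive part of its difference with half the unit separates them exactly.
  obtain ⟨a, ha⟩ := dense_nu A k (ε := 1 / 3) (by norm_num)
  have hval : ∀ N, yosidaValue ((a + (-1 / 2 : ℝ) • A.unit) ⊔ (0 : ℝ) • A.unit) N
      = (yosidaValue a N - 1 / 2) ⊔ 0 := fun N => by
    simp only [yosidaValue_sup, yosidaValue_add, yosidaValue_smul, yosidaValue_unit]
    congr 1 <;> ring
  refine ⟨(a + (-1 / 2 : ℝ) • A.unit) ⊔ (0 : ℝ) • A.unit, fun N hN => ?_, ?_⟩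
  · have h1 := abs_lt.1 (ha N)
    have h2 : k N = 0 := hk0 hN
    rw [hval]
    exact sup_eq_right.2 (by linarith)
  · have h1 := abs_lt.1 (ha M)
    have h2 : k M = 1 := hk1 rfl
    rw [hval]
    exact ((show 0 < yosidaValue a M - 1 / 2 by linarith).trans_le le_sup_left).ne'

/-! ## Duality between morphisms and continuous maps -/

/-- The point of the Yosida space given by a real-valued lattice functional. -/
def YosidaSpace.ofFunctional {A : WStar.{u}} (φ : A →ₗ[ℝ] ℝ)
    (hsup : ∀ a b : A, φ (a ⊔ b) = φ a ⊔ φ b) (hunit : φ A.unit = 1) : YosidaSpace A :=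
  ⟨LinearMap.ker φ, by
    have habs : ∀ a : A, φ |a| = |φ a| := fun a => by
      change φ (a ⊔ -a) = _
      rw [hsup, map_neg]
      rfl
    refine ⟨⟨fun x hx y hxy => ?_, ?_⟩, fun J hJ hIJ x hx => ?_⟩
    · have h1 : φ |x| = φ |y| ⊔ φ |x| := by rw [← hsup, sup_eq_right.2 hxy]
      have h2 : φ |y| ≤ φ |x| := by rw [h1]; exact le_sup_left
      have hx' : φ x = 0 := hx
      rw [habs, habs, hx', abs_zero] at h2
      exact abs_eq_zero.1 (le_antisymm h2 (abs_nonneg _))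
    · rw [LinearMap.mem_ker, hunit]
      exact one_ne_zero
    · have h1 : x - φ x • A.unit ∈ LinearMap.ker φ := by
        rw [LinearMap.mem_ker, map_sub, map_smul, hunit, smul_eq_mul, mul_one, sub_self]
      have h2 : φ x • A.unit ∈ J := by simpa using J.sub_mem hx (hIJ h1)
      by_contra hne
      refine hJ.2 ?_
      have := J.smul_mem (φ x)⁻¹ h2
      rwa [smul_smul, inv_mul_cancel₀ hne, one_smul] at this⟩

theorem yosidaValue_ofFunctional {A : WStar.{u}} (φ : A →ₗ[ℝ] ℝ)
    (hsup : ∀ a b : A, φ (a ⊔ b) = φ a ⊔ φ b) (hunit : φ A.unit = 1) (a : A) :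
    yosidaValue a (YosidaSpace.ofFunctional φ hsup hunit) = φ a := by
  refine yosidaValue_eq (LinearMap.mem_ker.2 ?_)
  rw [map_sub, map_smul, hunit, smul_eq_mul, mul_one, sub_self]

/-- Evaluation of a morphism `A → C(X)` at a point of `X`. -/
def evalFunctional {A : WStar.{u}} {X : CompHaus.{u}} (k : Hom A (ofCont X)) (x : X) :
    A →ₗ[ℝ] ℝ where
  toFun a := eval (k a) x
  map_add' a b := congrArg (eval · x) (k.map_add' a b)
  map_smul' r a := congrArg (eval · x) (k.map_smul' r a)

/-- The continuous map `X → YA` dual to a morphism `A → C(X)`. -/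
def dual {A : WStar.{u}} {X : CompHaus.{u}} (k : Hom A (ofCont X)) : C(X, yosida A) where
  toFun x := YosidaSpace.ofFunctional (evalFunctional k x)
    (fun a b => congrArg (eval · x) (k.map_sup' a b)) (congrArg (eval · x) k.map_unit')
  continuous_toFun := by
    refine continuous_generateFrom_iff.2 ?_
    rintro _ ⟨a, rfl⟩
    -- The preimage of the subbasic open set given by `a` is the cozero set of `k a`.
    exact isOpen_ne_fun (continuous_eval (k a)) continuous_const

theorem value_dual {A : WStar.{u}} {X : CompHaus.{u}} (k : Hom A (ofCont X)) (a : A) (x : X) :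
    value a (dual k x) = eval (k a) x :=
  yosidaValue_ofFunctional (evalFunctional k x)
    (fun a b => congrArg (eval · x) (k.map_sup' a b)) (congrArg (eval · x) k.map_unit') a

/-- The continuous map `YB → YA` induced by a morphism `A → B`. -/
noncomputable def yosidaMap {A B : WStar.{u}} (f : Hom A B) : C(yosida B, yosida A) :=
  dual ((nu B).comp f)

theorem value_yosidaMap {A B : WStar.{u}} (f : Hom A B) (a : A) (M : yosida B) :
    value a (yosidaMap f M) = value (f a) M :=
  value_dual _ _ _

theorem yosidaMap_comp {A B C : WStar.{u}} (g : Hom B C) (f : Hom A B) :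
    (yosidaMap (g.comp f) : yosida C → yosida A) = yosidaMap f ∘ yosidaMap g :=
  funext fun M => value_ext fun a => by
    rw [value_yosidaMap, Function.comp_apply, value_yosidaMap, value_yosidaMap]
    rfl

theorem Hom.ext_of_yosidaMap {A B : WStar.{u}} {f g : Hom A B}
    (h : (yosidaMap f : yosida B → yosida A) = yosidaMap g) : f = g :=
  Hom.ext fun a => eq_of_value fun M => by
    rw [← value_yosidaMap, ← value_yosidaMap, h]

/-- The values of `f a` are those of `a` along the range of the dual. A point missed by this closed
range is separated from it by a nonzero `a`, which `f` then kills. -/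
theorem injective_iff_surjective_yosidaMap {A B : WStar.{u}} {f : Hom A B} :
    Function.Injective f ↔ Function.Surjective (yosidaMap f) := by
  constructor
  · intro hf N
    by_contra hN
    obtain ⟨a, ha0, haN⟩ := exists_value_separating
      (isCompact_range (yosidaMap f).continuous).isClosed (M := N) hN
    have ha : a = 0 := f.injective_iff.1 hf a <| eq_zero_of_value fun M => by
      rw [← value_yosidaMap, ha0 _ ⟨M, rfl⟩]
    exact haN (ha ▸ value_zero N)
  · intro hs
    refine f.injective_iff.2 fun a ha => eq_zero_of_value fun N => ?_
    obtain ⟨M, rfl⟩ := hs N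
    rw [value_yosidaMap, ha, value_zero]

/-- An embedding is essential iff its Yosida dual is irreducible. -/
theorem isEssential_iff_isPerfectIrreducible {A B : WStar.{u}} {f : Hom A B} :
    f.IsEssential ↔ IsPerfectIrreducible (yosidaMap f) := by
  constructor
  · intro hf
    refine .of_irreducible (yosidaMap f).continuous (injective_iff_surjective_yosidaMap.1 hf.1)
      fun F hF hFu => Set.eq_univ_of_forall fun M => ?_
    have : CompactSpace F := isCompact_iff_compactSpace.1 hF.isCompact
    -- Essentiality is tested on the restriction `B → C(F)`: it is injective on `A` because `F` maps
    -- onto `YA`, hence injective on `B`, and then no point of `YB` can be separated from `F`.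
    let ι : C(CompHaus.of F, yosida B) := ⟨fun x : F => x.1, continuous_subtype_val⟩
    let k : Hom B (ofCont (CompHaus.of F)) := (ofContMap ι).comp (nu B)
    have hk : ∀ b (x : F), eval (k b) x = value b x.1 := fun _ _ => rfl
    have hinj : Function.Injective k := hf.2 _ k <| (k.comp f).injective_iff.2 fun a ha =>
      eq_zero_of_value fun N => by
        obtain ⟨M, hM, rfl⟩ := hFu ▸ Set.mem_univ N
        rw [value_yosidaMap, ← hk (f a) ⟨M, hM⟩]
        exact congrArg (eval · _) ha
    by_contra hM
    obtain ⟨b, hb0, hbM⟩ := exists_value_separating hF hM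
    have hb : b = 0 := k.injective_iff.1 hinj b <| eval_ext fun x : F => hb0 x.1 x.2
    exact hbM (hb ▸ value_zero M)
  · intro hf
    refine ⟨injective_iff_surjective_yosidaMap.2 hf.surjective, fun C k hk => ?_⟩
    rw [injective_iff_surjective_yosidaMap] at hk ⊢
    rw [yosidaMap_comp] at hk
    exact hf.surjective_of_comp (yosidaMap k).continuous hk

/-- The natural map `X → Y(C(X))`. -/
def point (X : CompHaus.{u}) : C(X, yosida (ofCont X)) := dual (Hom.id (ofCont X))

theorem value_point {X : CompHaus.{u}} (k : ofCont X) (x : X) : value k (point X x) = eval k x :=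
  value_dual (Hom.id (ofCont X)) k x

theorem exists_eval_ne {X : CompHaus.{u}} {x y : X} (hne : x ≠ y) :
    ∃ k : ofCont X, eval k x ≠ eval k y := by
  have hX : T2Space X := inferInstance
  have hX₁ : T1Space X := hX.t1Space
  have hX₂ : NormalSpace X := NormalSpace.of_compactSpace_r1Space
  obtain ⟨k, hk0, hk1, -⟩ := exists_continuous_zero_one_of_isClosed (isClosed_singleton (x := x))
    (isClosed_singleton (x := y)) (by simpa using hne)
  refine ⟨k, fun h => zero_ne_one (α := ℝ) ?_⟩
  calc (0 : ℝ) = k x := (hk0 rfl).symm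
    _ = k y := h
    _ = 1 := hk1 rfl

theorem point_injective (X : CompHaus.{u}) : Function.Injective (point X) := by
  intro x y hxy
  by_contra hne
  obtain ⟨k, hk⟩ := exists_eval_ne hne
  exact hk (by rw [← value_point, hxy, value_point])

/-- An element of `C(X)` separating a missed point from the image would vanish on all of `X`. -/
theorem point_surjective (X : CompHaus.{u}) : Function.Surjective (point X) := by
  intro N
  by_contra hN
  obtain ⟨k, hk0, hkN⟩ := exists_value_separating
    (isCompact_range (point X).continuous).isClosed (M := N) hN
  have hk : k = 0 := eval_ext fun x => by rw [← value_point, hk0 _ ⟨x, rfl⟩, eval_zero]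
  exact hkN (hk ▸ value_zero N)

theorem isHomeomorph_point (X : CompHaus.{u}) : IsHomeomorph (point X) :=
  isHomeomorph_iff_continuous_bijective.2
    ⟨(point X).continuous, point_injective X, point_surjective X⟩

/-- Surjectivity holds because a function on `Y(C(X))` is recovered from its pullback along the
surjection `point X`. -/
theorem nu_ofCont_bijective (X : CompHaus.{u}) : Function.Bijective (nu (ofCont X)) := by
  refine ⟨nu_injective _, fun k => ⟨ofContMap (point X) k, eval_ext fun M => ?_⟩⟩
  obtain ⟨x, rfl⟩ := point_surjective X M
  rw [eval_nu, value_point, eval_ofContMap]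

theorem ofContMap_bijective {X Y : CompHaus.{u}} {p : C(Y, X)} (hp : IsHomeomorph p) :
    Function.Bijective (ofContMap p) := by
  let e := hp.homeomorph
  refine ⟨fun k l hkl => eval_ext fun x => ?_, fun k => ⟨ofContMap ⟨e.symm, e.symm.continuous⟩ k,
    eval_ext fun y => ?_⟩⟩
  · obtain ⟨y, rfl⟩ := hp.surjective x
    exact congrArg (eval · y) hkl
  · rw [eval_ofContMap, eval_ofContMap]
    exact congrArg (eval k) (e.symm_apply_apply y)

/-- A cover `p` of `YA` gives an essential extension `A → C(YA) → C(Y)`. -/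
theorem isEssential_ofContMap_comp_nu {A : WStar.{u}} {Y : CompHaus.{u}} {p : C(Y, yosida A)}
    (hp : IsPerfectIrreducible p) : ((ofContMap p).comp (nu A)).IsEssential := by
  rw [isEssential_iff_isPerfectIrreducible]
  let e := (isHomeomorph_point Y).homeomorph
  -- Up to the identification `Y ≅ Y(C(Y))`, the dual of the composite is `p` itself.
  have h : (yosidaMap ((ofContMap p).comp (nu A)) : yosida (ofCont Y) → yosida A) = p ∘ e.symm := by
    funext M
    obtain ⟨y, rfl⟩ := point_surjective Y M
    rw [Function.comp_apply, show e.symm (point Y y) = y from e.symm_apply_apply y]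
    exact value_ext fun a => by
      rw [value_yosidaMap, value_point]
      rfl
  rw [h]
  exact hp.comp (.of_homeomorph e.symm)

end WStar

namespace WStar

/-! ## The hull operator of a covering operator -/

/-- Membership of `C(cYA)` in `fix(μ(c))` holds because its Yosida space is homeomorphic to `cYA`,
which is in `fix(c)`. For minimality, an essential extension `B` in `fix(μ(c))` has `YB` in `fix(c)`
and `B ≅ C(YB)`, so the map `YB → cYA` given by minimality of `cYA` dualizes to `C(cYA) → B`. -/
theorem isHullOperator_mu {c : CoverAssignment.{u}} (hc : IsCoveringOperator c) :
    IsHullOperator (mu c) := by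
  intro A
  refine ⟨isEssential_ofContMap_comp_nu (c (yosida A)).isCover, ?_, fun P hP hPfix => ?_⟩
  · have hfix := hc.mem_fix_of_homeomorph (hc (yosida A)).1 (isHomeomorph_point _).homeomorph
    exact Hom.isIso_iff_bijective.2 ((ofContMap_bijective hfix).comp (nu_ofCont_bijective _))
  · have hbij : Function.Bijective (mu c P.obj).hom := Hom.isIso_iff_bijective.1 hPfix
    have hY : IsHomeomorph (c (yosida P.obj)).map := by
      refine isHomeomorph_iff_continuous_bijective.2 ⟨(c (yosida P.obj)).map.continuous,
        fun x y hxy => ?_, (c (yosida P.obj)).isCover.surjective⟩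
      by_contra hne
      obtain ⟨k, hk⟩ := exists_eval_ne hne
      obtain ⟨b, rfl⟩ := hbij.2 k
      -- As `μ(c)` is onto here, every function on the cover factors through the covering map; since
      -- such functions separate points, that map is injective.
      exact hk (congrArg (value b) hxy)
    have hν : Function.Bijective (nu P.obj) :=
      (ofContMap_bijective hY).of_comp_iff' _ |>.1 hbij
    obtain ⟨q, hq⟩ := (hc (yosida A)).2
      ⟨yosida P.obj, yosidaMap P.hom, isEssential_iff_isPerfectIrreducible.1 hP⟩ hY
    refine ⟨((nu P.obj).inverse hν).comp (ofContMap q), Hom.ext fun a => hν.1 ?_⟩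
    refine Eq.trans (eval_ext fun M => ?_) ((nu P.obj).apply_inverse hν _).symm
    have h := value_yosidaMap P.hom a M
    rw [show yosidaMap P.hom M = (c (yosida A)).map (q M) from DFunLike.congr_fun hq M] at h
    exact h.symm

/-! ## The essential completion -/

/-- Morphisms between essential extensions of `A` are unique. -/
theorem Hom.IsEssential.hom_eq {A B C : WStar.{u}} {f : Hom A B} (hf : f.IsEssential)
    {j k : Hom B C} (hj : (j.comp f).IsEssential) (h : j.comp f = k.comp f) : j = k := by
  rw [isEssential_iff_isPerfectIrreducible] at hf hj
  refine Hom.ext_of_yosidaMap (hf.eq_of_comp_eq (yosidaMap j).continuous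
    (yosidaMap k).continuous ?_ ?_)
  · rwa [yosidaMap_comp] at hj
  · rw [← yosidaMap_comp, ← yosidaMap_comp, h]

/-- An essential extension `B` of `A` makes `YB` a cover of `YA`, so `gYA` maps to `YB`, and
composing gives `B → C(YB) → C(gYA)`. This also proves that `e` exists. -/
theorem isEssentialCompletionOperator_mu {g : CoverAssignment.{u}} (hg : IsGleasonOperator g) :
    IsEssentialCompletionOperator (mu g) := by
  intro A
  refine ⟨isEssential_ofContMap_comp_nu (g (yosida A)).isCover, fun P hP => ?_⟩
  obtain ⟨q, hq⟩ := hg (yosida A)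
    ⟨yosida P.obj, yosidaMap P.hom, isEssential_iff_isPerfectIrreducible.1 hP⟩
  refine ⟨(ofContMap q).comp (nu P.obj), Hom.ext fun a => eval_ext fun x => ?_⟩
  have h := value_yosidaMap P.hom a (q x)
  rw [show yosidaMap P.hom (q x) = (g (yosida A)).map x from (DFunLike.congr_fun hq x).symm] at h
  exact h

/-- The algebraic mirror of `IsGleasonOperator.isCoveringOperator`: a retraction `r : eeA → eA`
exists by maximality and uniqueness, and it is injective by essentiality, hence an inverse. -/
theorem IsEssentialCompletionOperator.isHullOperator {e : ExtensionAssignment.{u}}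
    (he : IsEssentialCompletionOperator e) : IsHullOperator e := by
  intro A
  refine ⟨(he A).1, ?_, fun P hP hPfix => ?_⟩
  · have hE := (he (e A).obj).1
    obtain ⟨r, hr⟩ := (he A).2 ⟨_, (e (e A).obj).hom.comp (e A).hom⟩ (hE.comp (he A).1)
    have hid : r.comp (e (e A).obj).hom = Hom.id _ :=
      (Hom.IsEssential.hom_eq (he A).1 (j := Hom.id _)
        (k := r.comp (e (e A).obj).hom) (he A).1 hr).symm
    have hleft := Hom.congr_apply hid
    have hrinj : Function.Injective r := hE.2 _ r fun x y hxy => by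
      rw [hid] at hxy
      exact hxy
    exact ⟨r, hid, Hom.ext fun x => hrinj (hleft (r x))⟩
  · obtain ⟨j, hj⟩ := (he A).2 P hP
    -- Thus `eA` is an essential extension of `P.obj`, so it maps to the essential completion of
    -- `P.obj`, which is `P.obj` itself up to isomorphism.
    have hje : j.IsEssential := Hom.IsEssential.of_comp (f := P.hom) (hj ▸ (he A).1) hP
    obtain ⟨q, hq⟩ := (he P.obj).2 ⟨_, j⟩ hje
    obtain ⟨s, hs, -⟩ := hPfix
    refine ⟨s.comp q, Hom.ext fun a => ?_⟩
    have h1 : (e A).hom a = j (P.hom a) := Hom.congr_apply hj a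
    have h2 : (e P.obj).hom (P.hom a) = q (j (P.hom a)) := Hom.congr_apply hq (P.hom a)
    have h3 : s ((e P.obj).hom (P.hom a)) = P.hom a := Hom.congr_apply hs (P.hom a)
    change P.hom a = s (q ((e A).hom a))
    rw [h1, ← h2, h3]

theorem IsEssentialCompletionOperator.sameOperator {h k : ExtensionAssignment.{u}}
    (hh : IsEssentialCompletionOperator h) (hk : IsEssentialCompletionOperator k) :
    SameOperator h k := fun A =>
  ⟨(hh A).1, (hk A).1, (hk A).2 _ (hh A).1, (hh A).2 _ (hk A).1⟩

/-! ## The uniform completion -/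

theorem mu_idCover : mu idCover.{u} = uniformCompletion := rfl

theorem IsHullOperator.sameOperator_self {h : ExtensionAssignment.{u}} (hh : IsHullOperator h) :
    SameOperator h h := fun A =>
  have hle : (h A).le (h A) := ⟨Hom.id _, rfl⟩
  ⟨(hh A).1, (hh A).1, hle, hle⟩

end WStar

theorem mainTheorem10 :
    -- `μ` maps covering operators to hull operators
    (∀ c : CoverAssignment.{u}, IsCoveringOperator c → WStar.IsHullOperator (WStar.mu c)) ∧
    -- `g` and `e` exist, and `μ(g) = e`
    ((∃ g : CoverAssignment.{u}, IsGleasonOperator g) ∧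
      (∃ e : WStar.ExtensionAssignment.{u}, WStar.IsEssentialCompletionOperator e) ∧
      ∀ (g : CoverAssignment.{u}) (e : WStar.ExtensionAssignment.{u}),
        IsGleasonOperator g → WStar.IsEssentialCompletionOperator e →
          IsCoveringOperator g ∧ WStar.IsHullOperator e ∧ WStar.SameOperator (WStar.mu g) e) ∧
    -- `μ(id) = u`
    (IsCoveringOperator idCover.{u} ∧ WStar.IsHullOperator WStar.uniformCompletion.{u} ∧
      WStar.SameOperator (WStar.mu idCover.{u}) WStar.uniformCompletion.{u} ∧
      -- `ν_A(A)` is uniformly dense in `uA = C(YA)`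
      ∀ (A : WStar.{u}) (k : C(WStar.yosida A, ℝ)) (ε : ℝ), 0 < ε →
        ∃ a : A, ∀ M : WStar.YosidaSpace A, |WStar.yosidaValue a M - k M| < ε) := by
  have hid : WStar.IsHullOperator WStar.uniformCompletion.{u} :=
    WStar.mu_idCover ▸ WStar.isHullOperator_mu isCoveringOperator_idCover
  refine ⟨fun c hc => WStar.isHullOperator_mu hc, ⟨exists_isGleasonOperator, ?_, fun g e hg he =>
    ⟨hg.isCoveringOperator, he.isHullOperator,
      (WStar.isEssentialCompletionOperator_mu hg).sameOperator he⟩⟩,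
    isCoveringOperator_idCover, hid, ?_, fun A k _ hε => WStar.dense_nu A k hε⟩
  · obtain ⟨g, hg⟩ := exists_isGleasonOperator.{u}
    exact ⟨_, WStar.isEssentialCompletionOperator_mu hg⟩
  · rw [WStar.mu_idCover]
    exact hid.sameOperator_self
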